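/- Let $f:\mathbb{R}^D\to\mathbb{R}^D$ be smooth ($C^\infty$), and let $\phi_{t,f}(x)$ denote the solution at time $t$ of $\dot y=f(y)$, $y(0)=x$. Let $a=(a_{ij})\in\mathbb{R}^{I\times I}$, $b\in\mathbb{R}^I$ be the coefficients of a consistent Runge–Kutta scheme, i.e. $\sum_i b_i=1$, and let $L\ge 0$ be an integer. For a vector field $g$, a point $x$ and small $h$, let $$\Phi_{h,g}(x)=x+h\sum_{i=1}^I b_i\,g(v_i),\qquad v_i=x+h\sum_{j=1}^I a_{ij}\,g(v_j)\quad(1\le i\le I),$$ where $(v_i)$ is the solution of the stage equations that tends to $(x,\dots,x)$ as $h\to0$, and let $\Phi^L_{h,g}(x)=x+h\sum_{i=1}^I b_i\,g(v_i^L)$ be its unrolled approximation, where $v_i^0=x$ and, for $l=1,\dots,L$, either $$v_i^l=x+h\sum_{j=1}^I a_{ij}\,g(v_j^{l-1})\qquad\text{(fixed-point iteration)}$$ or $$v_i^l=x+h\sum_{j=1}^I a_{ij}\bigl(g(v_j^{l-1})+g'(v_j^{l-1})(v_j^l-v_j^{l-1})\bigr)\qquad\text{(Newton–Raphson iteration)}.$$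 The inverse modified differential equation (IMDE) of a scheme $\Psi_h$ for $f$ is the formal power series $f_h=\sum_{k\ge0}h^kf_k$ with smooth coefficients $f_k:\mathbb{R}^D\to\mathbb{R}^D$ such that $\Psi_{h,f_h}(x)=\phi_{h,f}(x)$ for every $x\in\mathbb{R}^D$ as formal power series in $h$; that is, for every $x$ and every $N\ge0$, $\Psi_{h,f_h^N}(x)=\phi_{h,f}(x)+\mathcal{O}(h^{N+2})$ as $h\to0$, where $f_h^N=\sum_{k=0}^Nh^kf_k$. Then $\Phi_h$ and $\Phi_h^L$ (for either iteration) each have exactly one IMDE. If $\hat f_h=\sum_k h^k\hat f_k$ is the IMDE of $\Phi_h$ and $f_h=\sum_kh^kf_k$ is the IMDE of $\Phi_h^L$, then $$\hat f_h-f_h=\mathcal{O}(h^{L^*+1}),\quad\text{i.e.}\quad \hat f_k=f_k\ \text{ for } k=0,\dots,L^*,$$ where $L^*=L$ for fixed-point iteration and $L^*=2^{L+1}-2$ for Newton–Raphson iteration. -/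

import Mathlib

open Filter Topology Asymptotics
open scoped ContDiff

namespace UnrolledRK

/-- The state space `ℝ^D`. -/
abbrev State (D : ℕ) := EuclideanSpace ℝ (Fin D)

/-- `y` is the exact solution `t ↦ φ_{t,f}(x)` for `t` near `0`: it solves `y' = f(y)`, `y(0) = x`.
(Only the germ of `y` at `0` is constrained; for `f` of class `C¹` that germ is unique.) -/
def IsExactSolution {D : ℕ} (f : State D → State D) (x : State D) (y : ℝ → State D) : Prop :=
  y 0 = x ∧ ∀ᶠ t in 𝓝 (0 : ℝ), HasDerivAt y (f (y t)) t

/-- The final update `x + h ∑ i, b i • g (v i)` of a Runge-Kutta step with stages `v`. -/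
noncomputable def rkUpdate {D s : ℕ} (b : Fin s → ℝ) (g : State D → State D) (h : ℝ)
    (x : State D) (v : Fin s → State D) : State D :=
  x + h • ∑ i, b i • g (v i)

/-- A numerical one-step scheme, as the relation "`z h = Φ_{h, g h}(x)` for all small `h`" between
an `h`-dependent vector field `g`, an initial value `x` and a curve `z`. -/
abbrev Scheme (D : ℕ) := (ℝ → State D → State D) → State D → (ℝ → State D) → Prop

/-- The Runge-Kutta scheme with coefficients `a`, `b`, whose stages solve
`v i = x + h ∑ j, a i j • g h (v j)` exactly. The stage equations may have solutions far away from
`x`; the scheme uses the one that tends to `x` as `h → 0`. -/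
def exactRK {D s : ℕ} (a : Matrix (Fin s) (Fin s) ℝ) (b : Fin s → ℝ) : Scheme D :=
  fun g x z => ∃ v : ℝ → Fin s → State D,
    Tendsto v (𝓝 0) (𝓝 fun _ => x) ∧
    ∀ᶠ h in 𝓝 (0 : ℝ),
      (∀ i, v h i = x + h • ∑ j, a i j • g h (v h j)) ∧
      z h = rkUpdate b (g h) h x (v h)

/-- The Runge-Kutta scheme unrolled by `L` fixed-point iterations, started at `x`. -/
def fixedPointRK {D s : ℕ} (a : Matrix (Fin s) (Fin s) ℝ) (b : Fin s → ℝ) (L : ℕ) : Scheme D :=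
  fun g x z => ∃ v : ℕ → ℝ → Fin s → State D,
    ∀ᶠ h in 𝓝 (0 : ℝ),
      (∀ i, v 0 h i = x) ∧
      (∀ l < L, ∀ i, v (l + 1) h i = x + h • ∑ j, a i j • g h (v l h j)) ∧
      z h = rkUpdate b (g h) h x (v L h)

/-- The Runge-Kutta scheme unrolled by `L` Newton-Raphson iterations, started at `x`. Each iterate
solves a linear system, which is uniquely solvable for small `h`. -/
def newtonRK {D s : ℕ} (a : Matrix (Fin s) (Fin s) ℝ) (b : Fin s → ℝ) (L : ℕ) : Scheme D :=
  fun g x z => ∃ v : ℕ → ℝ → Fin s → State D,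
    ∀ᶠ h in 𝓝 (0 : ℝ),
      (∀ i, v 0 h i = x) ∧
      (∀ l < L, ∀ i, v (l + 1) h i = x + h • ∑ j, a i j •
        (g h (v l h j) + fderiv ℝ (g h) (v l h j) (v (l + 1) h j - v l h j))) ∧
      z h = rkUpdate b (g h) h x (v L h)

/-- The truncation `f_h^N = ∑_{k ≤ N} h^k f_k` of a formal vector field `∑ h^k f_k`. -/
noncomputable def truncation {D : ℕ} (F : ℕ → State D → State D) (N : ℕ) (h : ℝ) (x : State D) :
    State D :=
  ∑ k ∈ Finset.range (N + 1), h ^ k • F k x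

/-- The curve `c` agrees with the formal power series `∑ h^j d_j` up to and including `h^n`. -/
def ExpandsTo {D : ℕ} (c : ℝ → State D) (d : ℕ → State D) (n : ℕ) : Prop :=
  (fun h : ℝ => c h - ∑ j ∈ Finset.range (n + 1), h ^ j • d j) =O[𝓝 0] fun h : ℝ => h ^ (n + 1)

/-- `∑ h^j d_j` is the formal power series in `h` of `φ_{h,f}(x)`, i.e. its Taylor series. -/
def IsExactSeries {D : ℕ} (f : State D → State D) (x : State D) (d : ℕ → State D) : Prop :=
  ∃ y, IsExactSolution f x y ∧ ∀ n, ExpandsTo y d n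

/-- `∑ h^j d_j` is the formal power series in `h` of `Φ_{h,f_h}(x)`, with `f_h = ∑ h^k f_k` a formal
power series itself. As `Φ_{h,g}(x) = x + h (⋯)`, the coefficients up to `h^(N+1)` involve only
`f_0, …, f_N`, so they are those of `Φ_{h,f_h^N}(x)`. -/
def IsSchemeSeries {D : ℕ} (Φ : Scheme D) (F : ℕ → State D → State D) (x : State D)
    (d : ℕ → State D) : Prop :=
  ∀ N, ∃ z, Φ (truncation F N) x z ∧ ExpandsTo z d (N + 1)

/-- `f_h = ∑ h^k F_k`, with smooth coefficients, is the inverse modified differential equation of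
the scheme `Φ` for the vector field `f`: `Φ_{h,f_h}(x) = φ_{h,f}(x)` for every `x`, as formal power
series in `h`. -/
def IsIMDE {D : ℕ} (Φ : Scheme D) (f : State D → State D) (F : ℕ → State D → State D) : Prop :=
  (∀ k, ContDiff ℝ ∞ (F k)) ∧
  ∀ x, ∃ d, IsExactSeries f x d ∧ IsSchemeSeries Φ F x d

end UnrolledRK

/-!
The stages of a Runge-Kutta step, all iterates of an unrolled step together, and the results of both
solve an implicit equation `V = w + h T(h, V)`. Its branch through `w` expands in powers of `h`, and
adding `h ^ N • K` to the vector field adds `h ^ (N + 1) • (∑ i, b i) • K` to the result, to leading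
order. Since `∑ i, b i ≠ 0`, the coefficients of the modified field can be solved for one after the
other, each uniquely, and schemes agreeing up to `O(h ^ (M + 2))` have equal coefficients `0, …, M`.

An iterate of error `O(h ^ p)` is followed by one of error `O(h ^ (r * p + 1))`, with `r = 1` for
fixed-point and `r = 2` for Newton-Raphson iteration. So the last stages have error
`O(h ^ ∑ k ≤ L, r ^ k)`, and the factor `h` in the final update gains one more power.
-/

namespace UnrolledRK

open Function (uncurry)

theorem tendsto_family_apply {X Y Z : Type*} [TopologicalSpace X] [TopologicalSpace Y]
    [TopologicalSpace Z] {G : X → Y → Z} (hG : Continuous (uncurry G)) {u : X → Y} {q : X} {p : Y}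
    (hu : Tendsto u (𝓝 q) (𝓝 p)) : Tendsto (fun t => G t (u t)) (𝓝 q) (𝓝 (G q p)) :=
  (hG.tendsto (q, p)).comp (tendsto_id.prodMk_nhds hu)

section Asymptotics

variable {E F P : Type*} [NormedAddCommGroup E] [NormedSpace ℝ E]
  [NormedAddCommGroup F] [NormedSpace ℝ F] [NormedAddCommGroup P] [NormedSpace ℝ P]
  {n : WithTop ℕ∞}

theorem isBigO_pow_pow_of_le {m k : ℕ} (hmk : m ≤ k) :
    (fun h : ℝ => h ^ k) =O[𝓝 0] fun h : ℝ => h ^ m := by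
  obtain rfl | hlt := hmk.eq_or_lt
  · exact isBigO_refl _ _
  · exact (isLittleO_pow_pow hlt).isBigO

theorem isBigO_smul_pow_succ {u : ℝ → E} {k : ℕ} (hu : u =O[𝓝 0] fun h : ℝ => h ^ k) :
    (fun h => h • u h) =O[𝓝 0] fun h : ℝ => h ^ (k + 1) := by
  simpa only [pow_succ', smul_eq_mul] using (isBigO_refl (fun h : ℝ => h) (𝓝 0)).smul hu

theorem isBigO_pow_smul_const (k : ℕ) (e : E) :
    (fun h : ℝ => h ^ k • e) =O[𝓝 0] fun h : ℝ => h ^ k := by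
  simpa only [smul_eq_mul, mul_one] using
    (isBigO_refl (fun h : ℝ => h ^ k) (𝓝 0)).smul (isBigO_const_const e (one_ne_zero (α := ℝ)) _)

theorem isBigO_of_eventually_eq_add_smul {e r q : ℝ → E}
    (he : ∀ᶠ h in 𝓝 (0 : ℝ), e h = r h + h • q h) (hq : q =O[𝓝 0] e) : e =O[𝓝 0] r := by
  have hsmall : (fun h : ℝ => h • q h) =o[𝓝 0] e := by
    simpa only [id, one_smul] using
      ((isLittleO_one_iff ℝ).2 (tendsto_id (α := ℝ) (x := 𝓝 0))).smul_isBigO hq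
  refine hsmall.right_isBigO_sub.trans_eventuallyEq ?_
  filter_upwards [he] with h hh
  rw [hh, add_sub_cancel_right]

theorem eq_zero_of_pow_smul_isBigO {k : ℕ} {e : E}
    (h : (fun h : ℝ => h ^ k • e) =O[𝓝 0] fun h : ℝ => h ^ (k + 1)) : e = 0 := by
  have := IsBigO.continuousMultilinearMap_apply_eq_zero
    (p := ContinuousMultilinearMap.mkPiRing ℝ (Fin k) e)
    (by simpa using h.trans (isBigO_refl _ _).norm_right) 1
  simpa using this

theorem eq_zero_of_sum_pow_smul_isBigO {k : ℕ} {c : ℕ → E}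
    (h : (fun h : ℝ => ∑ j ∈ Finset.range k, h ^ j • c j) =O[𝓝 0] fun h : ℝ => h ^ k) :
    ∀ j < k, c j = 0 := by
  induction k with
  | zero => simp
  | succ k ih =>
    have hlow : ∀ j < k, c j = 0 := by
      refine ih (((h.trans (isBigO_pow_pow_of_le k.le_succ)).sub
        (isBigO_pow_smul_const k (c k))).congr_left fun t => ?_)
      rw [Finset.sum_range_succ, add_sub_cancel_right]
    have htop : c k = 0 := by
      refine eq_zero_of_pow_smul_isBigO (h.congr_left fun t => ?_)
      rw [Finset.sum_range_succ, Finset.sum_eq_zero, zero_add]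
      exact fun j hj => by rw [hlow j (Finset.mem_range.1 hj), smul_zero]
    exact fun j hj => (Nat.lt_succ_iff_lt_or_eq.1 hj).elim (hlow j) fun hjk => hjk ▸ htop

theorem isBigO_pow_succ_of_hasDerivAt {c c' : ℝ → E} {k : ℕ} (h0 : c 0 = 0)
    (hc : ∀ᶠ h in 𝓝 (0 : ℝ), HasDerivAt c (c' h) h) (hc' : c' =O[𝓝 0] fun h : ℝ => h ^ k) :
    c =O[𝓝 0] fun h : ℝ => h ^ (k + 1) := by
  have hfderiv : fderiv ℝ c =O[𝓝 0] (‖· - 0‖ ^ (k : ℝ)) := by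
    refine IsBigO.of_norm_left (hc'.norm_norm.congr' ?_ (.of_forall fun h => by simp))
    filter_upwards [hc] with h hh
    rw [← norm_deriv_eq_norm_fderiv, hh.deriv]
  have := isBigO_norm_rpow_add_one_of_fderiv_of_apply_eq_zero k.cast_nonneg
    (hc.mono fun h hh => hh.differentiableAt) hfderiv h0
  refine IsBigO.of_norm_right (this.congr_right fun h => ?_)
  rw [sub_zero, norm_pow, ← Nat.cast_succ, Real.rpow_natCast]

theorem isBigO_sub_taylor_of_hasDerivAt {c : ℕ → ℝ → E}
    (hc : ∀ j, ∀ᶠ h in 𝓝 (0 : ℝ), HasDerivAt (c j) (c (j + 1) h) h) (k : ℕ) :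
    (fun h : ℝ => c 0 h - ∑ j ∈ Finset.range k, h ^ j • ((j.factorial : ℝ)⁻¹ • c j 0)) =O[𝓝 0]
      fun h : ℝ => h ^ k := by
  induction k generalizing c with
  | zero => simpa using (hc 0).self_of_nhds.continuousAt.tendsto.isBigO_one ℝ
  | succ k ih =>
    refine isBigO_pow_succ_of_hasDerivAt ?_ ?_ (ih fun j => hc (j + 1))
    · simp [Finset.sum_range_succ']
    · have hmonomial (j : ℕ) (h : ℝ) :
          HasDerivAt (fun h : ℝ => h ^ (j + 1) • (((j + 1).factorial : ℝ)⁻¹ • c (j + 1) 0))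
            (h ^ j • ((j.factorial : ℝ)⁻¹ • c (j + 1) 0)) h := by
        convert! (hasDerivAt_pow (j + 1) h).smul_const (((j + 1).factorial : ℝ)⁻¹ • c (j + 1) 0)
          using 1
        rw [smul_smul, smul_smul, Nat.factorial_succ, add_tsub_cancel_right]
        push_cast
        congr 1
        field_simp
      filter_upwards [hc 0] with h hh
      simp only [Finset.sum_range_succ' _ k, pow_zero]
      exact hh.fun_sub ((HasDerivAt.fun_sum fun j _ => hmonomial j h).add_const _)

theorem norm_sub_sub_fderiv_apply_le {f : E → F} {s : Set E} {K : NNReal} (hs : Convex ℝ s)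
    (hf : ∀ x ∈ s, DifferentiableAt ℝ f x) (hK : LipschitzOnWith K (fderiv ℝ f) s) {x y : E}
    (hx : x ∈ s) (hy : y ∈ s) : ‖f y - f x - fderiv ℝ f x (y - x)‖ ≤ K * ‖y - x‖ ^ 2 := by
  have hseg : segment ℝ x y ⊆ s := hs.segment_subset hx hy
  have hbound : ∀ z ∈ segment ℝ x y, ‖fderiv ℝ f z - fderiv ℝ f x‖ ≤ K * ‖y - x‖ := fun z hz =>
    (hK.norm_sub_le (hseg hz) hx).trans <| by
      gcongr
      exact norm_sub_le_of_mem_segment hz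
  rw [sq, ← mul_assoc]
  exact (convex_segment x y).norm_image_sub_le_of_norm_fderiv_le' (fun z hz => hf z (hseg hz))
    hbound (left_mem_segment ℝ x y) (right_mem_segment ℝ x y)

theorem isBigO_comp_sub_comp {α : Type*} {l : Filter α} {f : E → F} {p : E}
    (hf : ContDiffAt ℝ n f p) (hn : n ≠ 0) {u v : α → E} (hu : Tendsto u l (𝓝 p))
    (hv : Tendsto v l (𝓝 p)) : (fun t => f (u t) - f (v t)) =O[l] fun t => u t - v t :=
  (hf.hasStrictFDerivAt hn).isBigO_sub.comp_tendsto (hu.prodMk_nhds hv)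

variable {G : P → E → F} {q : P} {p : E} {u v : P → E}

theorem contDiff_family_apply (hG : ContDiff ℝ n (uncurry G)) (t : P) : ContDiff ℝ n (G t) :=
  hG.comp (contDiff_const.prodMk contDiff_id)

theorem contDiff_family_fderiv {m : WithTop ℕ∞} (hG : ContDiff ℝ n (uncurry G))
    (hmn : m + 1 ≤ n) : ContDiff ℝ m (uncurry fun t => fderiv ℝ (G t)) :=
  ContDiff.fderiv (f := fun (z : P × E) x => G z.1 x) (g := fun z => z.2)
    (hG.comp ((contDiff_fst.comp contDiff_fst).prodMk contDiff_snd)) contDiff_snd hmn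

theorem contDiff_family_add_pow_smul {G : ℝ → E → F} (hG : ContDiff ℝ n (uncurry G)) {K : E → F}
    (hK : ContDiff ℝ n K) (N : ℕ) : ContDiff ℝ n (uncurry fun h x => G h x + h ^ N • K x) :=
  hG.add ((contDiff_fst.pow N).smul (hK.comp contDiff_snd))

theorem isBigO_family_sub (hG : ContDiff ℝ n (uncurry G)) (hn : n ≠ 0)
    (hu : Tendsto u (𝓝 q) (𝓝 p)) (hv : Tendsto v (𝓝 q) (𝓝 p)) :
    (fun t => G t (u t) - G t (v t)) =O[𝓝 q] fun t => u t - v t := by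
  have hpair : (fun t => (t, u t) - (t, v t)) =O[𝓝 q] fun t => u t - v t :=
    IsBigO.of_norm_left <| by simpa [Prod.norm_def] using (isBigO_refl _ _).norm_left
  exact (isBigO_comp_sub_comp hG.contDiffAt hn (tendsto_id.prodMk_nhds hu)
    (tendsto_id.prodMk_nhds hv)).trans hpair

theorem isBigO_family_fderiv_apply (hG : ContDiff ℝ n (uncurry G)) (hn : n ≠ 0)
    (hu : Tendsto u (𝓝 q) (𝓝 p)) (e : P → E) :
    (fun t => fderiv ℝ (G t) (u t) (e t)) =O[𝓝 q] e := by
  have hbounded : (fun t => fderiv ℝ (G t) (u t)) =O[𝓝 q] fun _ => (1 : ℝ) :=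
    (tendsto_family_apply (contDiff_family_fderiv (m := 0) hG
      (by simpa using ENat.one_le_iff_ne_zero_withTop.2 hn)).continuous hu).isBigO_one ℝ
  have hle : (fun t => fderiv ℝ (G t) (u t) (e t)) =O[𝓝 q]
      fun t => ‖fderiv ℝ (G t) (u t)‖ * ‖e t‖ :=
    IsBigO.of_norm_le fun t => ContinuousLinearMap.le_opNorm _ _
  simpa using hle.trans (hbounded.norm_left.mul (isBigO_refl e _).norm_norm)

theorem isBigO_family_sub_sub_fderiv (hG : ContDiff ℝ n (uncurry G)) (hn : 2 ≤ n)
    (hu : Tendsto u (𝓝 q) (𝓝 p)) (hv : Tendsto v (𝓝 q) (𝓝 p)) :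
    (fun t => G t (u t) - G t (v t) - fderiv ℝ (G t) (v t) (u t - v t)) =O[𝓝 q]
      fun t => ‖u t - v t‖ ^ 2 := by
  obtain ⟨K, s, hs, hK⟩ := (contDiff_family_fderiv (m := 1) hG
    (by rwa [one_add_one_eq_two])).contDiffAt (x := (q, p)) |>.exists_lipschitzOnWith
  obtain ⟨r, hr, hrs⟩ := Metric.mem_nhds_iff.1 hs
  rw [← ball_prod_same] at hrs
  refine IsBigO.of_bound K ?_
  filter_upwards [hu (Metric.ball_mem_nhds p hr), hv (Metric.ball_mem_nhds p hr),
    Metric.ball_mem_nhds q hr] with t hut hvt ht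
  have hKt : LipschitzOnWith K (fderiv ℝ (G t)) (Metric.ball p r) := fun x hx y hy => by
    simpa [Prod.edist_eq] using hK (hrs (Set.mk_mem_prod ht hx)) (hrs (Set.mk_mem_prod ht hy))
  rw [norm_pow, norm_norm]
  exact norm_sub_sub_fderiv_apply_le (convex_ball p r)
    (fun x _ => (contDiff_family_apply hG t).differentiable (by positivity) x) hKt hvt hut

/-- The derivative of a family of maps in its real parameter, as a family of maps. -/
noncomputable def paramDeriv (Z : ℝ → E → F) (h : ℝ) (x : E) : F :=
  deriv (fun t => Z t x) h

theorem contDiff_iterate_paramDeriv {Z : ℝ → E → F} (hZ : ContDiff ℝ ∞ (uncurry Z)) (j : ℕ) :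
    ContDiff ℝ ∞ (uncurry (paramDeriv^[j] Z)) := by
  induction j with
  | zero => exact hZ
  | succ j ih =>
    rw [Function.iterate_succ_apply']
    exact ContDiff.fderiv_apply (f := fun (p : ℝ × E) t => (paramDeriv^[j] Z) t p.2)
      (g := fun p => p.1) (k := fun _ => 1)
      (ih.comp (contDiff_snd.prodMk (contDiff_snd.comp contDiff_fst))) contDiff_fst contDiff_const
      (by simp)

theorem exists_contDiff_coeff {Z : ℝ → E → F} (hZ : ContDiff ℝ ∞ (uncurry Z)) :
    ∃ c : ℕ → E → F, (∀ j, ContDiff ℝ ∞ (c j)) ∧ ∀ x k,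
      (fun h : ℝ => Z h x - ∑ j ∈ Finset.range k, h ^ j • c j x) =O[𝓝 0] fun h : ℝ => h ^ k := by
  refine ⟨fun j x => (j.factorial : ℝ)⁻¹ • (paramDeriv^[j] Z) 0 x, fun j => ?_, fun x k => ?_⟩
  · exact contDiff_const.smul (contDiff_family_apply (contDiff_iterate_paramDeriv hZ j) 0)
  · refine isBigO_sub_taylor_of_hasDerivAt (c := fun j h => (paramDeriv^[j] Z) h x)
      (fun j => .of_forall fun h => ?_) k
    have hj : ContDiff ℝ ∞ fun t => (paramDeriv^[j] Z) t x :=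
      (contDiff_iterate_paramDeriv hZ j).comp (contDiff_id.prodMk contDiff_const)
    rw [Function.iterate_succ_apply']
    exact (hj.differentiable (by simp) h).hasDerivAt

end Asymptotics

section ExactFlow

variable {E : Type*} [NormedAddCommGroup E] [NormedSpace ℝ E] {f : E → E}

/-- The iterated Lie derivatives of the identity map along the vector field `f`. -/
noncomputable def lieIterate (f : E → E) : ℕ → E → E
  | 0 => id
  | j + 1 => fun x => fderiv ℝ (lieIterate f j) x (f x)

/-- The Taylor coefficients in `t` of the flow of `f`: formally `φ_t(x) = ∑ t^j flowCoeff f j x`. -/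
noncomputable def flowCoeff (f : E → E) (j : ℕ) (x : E) : E :=
  (j.factorial : ℝ)⁻¹ • lieIterate f j x

theorem flowCoeff_zero (x : E) : flowCoeff f 0 x = x := by
  simp [flowCoeff, lieIterate]

theorem contDiff_lieIterate (hf : ContDiff ℝ ∞ f) (j : ℕ) : ContDiff ℝ ∞ (lieIterate f j) := by
  induction j with
  | zero => exact contDiff_id
  | succ j ih => exact (ih.fderiv_right (m := ∞) (by simp)).clm_apply hf

theorem contDiff_flowCoeff (hf : ContDiff ℝ ∞ f) (j : ℕ) : ContDiff ℝ ∞ (flowCoeff f j) :=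
  (contDiff_lieIterate hf j).const_smul (j.factorial : ℝ)⁻¹

variable {D : ℕ} {f : State D → State D} {x : State D}

theorem exists_isExactSolution (hf : ContDiffAt ℝ 1 f x) : ∃ y, IsExactSolution f x y := by
  obtain ⟨y, hy0, ε, hε, hy⟩ :=
    hf.exists_forall_mem_closedBall_exists_eq_forall_mem_Ioo_hasDerivAt₀ 0
  refine ⟨y, hy0, ?_⟩
  filter_upwards [Ioo_mem_nhds (sub_lt_self 0 hε) (lt_add_of_pos_right 0 hε)] with t ht
  exact hy t ht

theorem IsExactSolution.expandsTo (hf : ContDiff ℝ ∞ f) {y : ℝ → State D}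
    (hy : IsExactSolution f x y) (n : ℕ) : ExpandsTo y (fun j => flowCoeff f j x) n := by
  have hderiv : ∀ j, ∀ᶠ t in 𝓝 (0 : ℝ),
      HasDerivAt (fun t => lieIterate f j (y t)) (lieIterate f (j + 1) (y t)) t := fun j => by
    filter_upwards [hy.2] with t ht
    exact ((contDiff_lieIterate hf j).differentiable (by simp) (y t)).hasFDerivAt.comp_hasDerivAt
      t ht
  simpa only [ExpandsTo, flowCoeff, hy.1, lieIterate, id] using
    isBigO_sub_taylor_of_hasDerivAt hderiv (n + 1)

theorem ExpandsTo.coeff_eq {z : ℝ → State D} {c d : ℕ → State D} {n : ℕ} (hc : ExpandsTo z c n)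
    (hd : ExpandsTo z d n) {j : ℕ} (hj : j ≤ n) : c j = d j := by
  refine sub_eq_zero.1 (eq_zero_of_sum_pow_smul_isBigO (k := n + 1) (c := fun j => c j - d j)
    ((hd.sub hc).congr_left fun h => ?_) j (Nat.lt_succ_of_le hj))
  simp only [smul_sub, Finset.sum_sub_distrib]
  abel

theorem ExpandsTo.of_succ {z : ℝ → State D} {d : ℕ → State D} {n : ℕ}
    (h : ExpandsTo z d (n + 1)) : ExpandsTo z d n := by
  refine ((h.trans (isBigO_pow_pow_of_le (n + 1).le_succ)).add
    (isBigO_pow_smul_const (n + 1) (d (n + 1)))).congr_left fun t => ?_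
  rw [Finset.sum_range_succ _ (n + 1)]
  abel

theorem isExactSeries_iff (hf : ContDiff ℝ ∞ f) {d : ℕ → State D} :
    IsExactSeries f x d ↔ d = fun j => flowCoeff f j x := by
  constructor
  · rintro ⟨y, hy, hyd⟩
    exact funext fun j => (hyd j).coeff_eq (hy.expandsTo hf j) le_rfl
  · rintro rfl
    obtain ⟨y, hy⟩ := exists_isExactSolution (hf.of_le (by simp)).contDiffAt
    exact ⟨y, hy, hy.expandsTo hf⟩

theorem isIMDE_iff (hf : ContDiff ℝ ∞ f) {Φ : Scheme D} {F : ℕ → State D → State D} :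
    IsIMDE Φ f F ↔ (∀ k, ContDiff ℝ ∞ (F k)) ∧
      ∀ x, IsSchemeSeries Φ F x fun j => flowCoeff f j x := by
  simp only [IsIMDE, isExactSeries_iff hf, exists_eq_left]

end ExactFlow

section Branches

variable {W : Type*} [NormedAddCommGroup W] [NormedSpace ℝ W] {T : ℝ → W → W} {w : W}
  {V V' : ℝ → W} {n : WithTop ℕ∞}

/-- `V` is the branch through `w` at `h = 0` of the solutions of `V = w + h T(h, V)`; as in
`exactRK`, solutions of the equation that stay away from `w` are excluded. -/
def IsBranch (T : ℝ → W → W) (w : W) (V : ℝ → W) : Prop :=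
  Tendsto V (𝓝 0) (𝓝 w) ∧ ∀ᶠ h in 𝓝 (0 : ℝ), V h = w + h • T h (V h)

theorem exists_isBranch [CompleteSpace W] (hT : ContDiff ℝ n (uncurry T)) (hn : n ≠ 0) (w : W) :
    ∃ V, IsBranch T w V := by
  let R : ℝ × W → W := fun p => p.2 - p.1 • T p.1 p.2
  have hR : HasStrictFDerivAt R (fderiv ℝ R (0, w)) (0, w) :=
    (contDiff_snd.sub (contDiff_fst.smul hT)).contDiffAt.hasStrictFDerivAt hn
  have hpartial : fderiv ℝ R (0, w) ∘L .inr ℝ ℝ W = .id ℝ W := by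
    refine (hR.hasFDerivAt.comp w (hasFDerivAt_prodMk_right (0 : ℝ) w)).unique ?_
    simp only [R, Function.comp_def, zero_smul, sub_zero]
    exact hasFDerivAt_id w
  have hinv : (fderiv ℝ R (0, w) ∘L .inr ℝ ℝ W).IsInvertible := hpartial ▸ ⟨.refl ℝ W, rfl⟩
  refine ⟨hR.implicitFunctionOfProdDomain hinv, hR.tendsto_implicitFunctionOfProdDomain hinv, ?_⟩
  filter_upwards [hR.eventually_apply_implicitFunctionOfProdDomain hinv] with h hh
  simpa [R, sub_eq_iff_eq_add] using hh

theorem IsBranch.isBigO_sub (hT : Continuous (uncurry T)) (hV : IsBranch T w V) :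
    (fun h => V h - w) =O[𝓝 0] fun h : ℝ => h ^ 1 := by
  have hbounded : (fun h => T h (V h)) =O[𝓝 0] fun h : ℝ => h ^ 0 := by
    simpa only [pow_zero] using (tendsto_family_apply hT hV.1).isBigO_one ℝ
  refine (isBigO_smul_pow_succ hbounded).congr' ?_ .rfl
  filter_upwards [hV.2] with h hh
  rw [eq_sub_iff_add_eq', ← hh]

theorem IsBranch.isBigO_sub_sub_of_perturb (hT : ContDiff ℝ n (uncurry T)) {S : W → W}
    (hS : ContDiff ℝ n S) (hn : n ≠ 0) {N : ℕ} (hV : IsBranch T w V)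
    (hV' : IsBranch (fun h v => T h v + h ^ N • S v) w V') :
    (fun h => V' h - V h - h ^ (N + 1) • S w) =O[𝓝 0] fun h : ℝ => h ^ (N + 2) := by
  have hT' : Continuous (uncurry fun h v => T h v + h ^ N • S v) :=
    hT.continuous.add ((continuous_fst.pow N).smul (hS.continuous.comp continuous_snd))
  have hdiff : ∀ᶠ h in 𝓝 (0 : ℝ),
      V' h - V h = h • h ^ N • S (V' h) + h • (T h (V' h) - T h (V h)) := by
    filter_upwards [hV.2, hV'.2] with h hh hh'
    rw [← sub_eq_zero]
    nth_rw 1 [hh, hh']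
    module
  have hS_bounded : (fun h => h • h ^ N • S (V' h)) =O[𝓝 0] fun h : ℝ => h ^ (N + 1) := by
    refine isBigO_smul_pow_succ ?_
    simpa only [smul_eq_mul, mul_one, Function.comp_apply] using
      (isBigO_refl (fun h : ℝ => h ^ N) (𝓝 0)).smul
        ((hS.continuous.continuousAt.tendsto.comp hV'.1).isBigO_one ℝ)
  have hVV' : (fun h => V' h - V h) =O[𝓝 0] fun h : ℝ => h ^ (N + 1) :=
    (isBigO_of_eventually_eq_add_smul hdiff (isBigO_family_sub hT hn hV'.1 hV.1)).trans hS_bounded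
  have hT_sub : (fun h => h • (T h (V' h) - T h (V h))) =O[𝓝 0] fun h : ℝ => h ^ (N + 2) :=
    isBigO_smul_pow_succ ((isBigO_family_sub hT hn hV'.1 hV.1).trans hVV')
  have hS_sub : (fun h => h ^ (N + 1) • (S (V' h) - S w)) =O[𝓝 0] fun h : ℝ => h ^ (N + 2) := by
    simpa only [smul_eq_mul, ← pow_add] using (isBigO_refl (fun h : ℝ => h ^ (N + 1)) (𝓝 0)).smul
      ((isBigO_comp_sub_comp hS.contDiffAt hn hV'.1 tendsto_const_nhds).trans (hV'.isBigO_sub hT'))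
  refine (hT_sub.add hS_sub).congr' ?_ .rfl
  filter_upwards [hdiff] with h hh
  rw [hh]
  module

/-- The Picard iterates of `V = w + h T(h, V)`, which are smooth in `(h, w)` jointly. -/
noncomputable def picardIterate (T : ℝ → W → W) : ℕ → ℝ → W → W
  | 0 => fun _ w => w
  | k + 1 => fun h w => w + h • T h (picardIterate T k h w)

theorem contDiff_picardIterate (hT : ContDiff ℝ n (uncurry T)) (k : ℕ) :
    ContDiff ℝ n (uncurry (picardIterate T k)) := by
  induction k with
  | zero => exact contDiff_snd
  | succ k ih => exact contDiff_snd.add (contDiff_fst.smul (hT.comp (contDiff_fst.prodMk ih)))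

theorem tendsto_picardIterate (hT : ContDiff ℝ n (uncurry T)) (k : ℕ) (w : W) :
    Tendsto (fun h => picardIterate T k h w) (𝓝 0) (𝓝 w) := by
  have hzero : picardIterate T k 0 w = w := by cases k <;> simp [picardIterate]
  simpa only [hzero] using tendsto_family_apply (q := 0) (contDiff_picardIterate hT k).continuous
    (tendsto_const_nhds (x := w))

theorem IsBranch.isBigO_sub_picardIterate (hT : ContDiff ℝ n (uncurry T)) (hn : n ≠ 0)
    (hV : IsBranch T w V) (k : ℕ) :
    (fun h => V h - picardIterate T k h w) =O[𝓝 0] fun h : ℝ => h ^ (k + 1) := by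
  induction k with
  | zero => exact hV.isBigO_sub hT.continuous
  | succ k ih =>
    refine (isBigO_smul_pow_succ ((isBigO_family_sub hT hn hV.1
      (tendsto_picardIterate hT k w)).trans ih)).congr' ?_ .rfl
    filter_upwards [hV.2] with h hh
    nth_rw 2 [hh]
    rw [picardIterate, add_sub_add_left_eq_sub, smul_sub]

end Branches

section Unrolling

variable {W : Type*} [NormedAddCommGroup W] [NormedSpace ℝ W] {n : WithTop ℕ∞}

/-- The right-hand side of the system satisfied by all iterates `V 0, …, V L` together, which is
again of the form `V = w + h T(h, V)`: its entry at `l + 1` is the linearization of `T` at `V l`,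
with derivative term damped by `ε`. The fixed-point iteration is `ε = 0`, the Newton-Raphson
iteration is `ε = 1`. -/
noncomputable def unrolledRhs (T : W → W) (ε : ℝ) (L : ℕ) (V : Fin (L + 1) → W) : Fin (L + 1) → W :=
  Fin.cons 0 fun l : Fin L =>
    T (V l.castSucc) + ε • fderiv ℝ T (V l.castSucc) (V l.succ - V l.castSucc)

theorem contDiff_unrolledRhs {T : ℝ → W → W} (hT : ContDiff ℝ ∞ (uncurry T)) (ε : ℝ) (L : ℕ) :
    ContDiff ℝ ∞ (uncurry fun h => unrolledRhs (T h) ε L) := by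
  have hiterate (l : Fin (L + 1)) : ContDiff ℝ ∞ fun p : ℝ × (Fin (L + 1) → W) => p.2 l :=
    (contDiff_apply ℝ W l).comp contDiff_snd
  refine contDiff_pi.2 (Fin.cases contDiff_const fun l => ?_)
  have hprev := contDiff_fst.prodMk (hiterate l.castSucc)
  exact (hT.comp hprev).add ((((contDiff_family_fderiv hT (by simp)).comp hprev).clm_apply
    ((hiterate l.succ).sub (hiterate l.castSucc))).const_smul ε)

theorem unrolledRhs_add_smul {T S : W → W} (hT : Differentiable ℝ T) (hS : Differentiable ℝ S)
    (c ε : ℝ) (L : ℕ) (V : Fin (L + 1) → W) :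
    unrolledRhs (fun v => T v + c • S v) ε L V =
      unrolledRhs T ε L V + c • unrolledRhs S ε L V := by
  have hfderiv (v : W) : fderiv ℝ (fun v => T v + c • S v) v = fderiv ℝ T v + c • fderiv ℝ S v :=
    ((hT v).hasFDerivAt.add ((hS v).hasFDerivAt.const_smul c)).fderiv
  refine funext (Fin.cases (by simp [unrolledRhs]) fun l => ?_)
  simp only [unrolledRhs, Fin.cons_succ, Pi.add_apply, Pi.smul_apply, hfderiv, add_apply,
    smul_apply]
  module

/-- `v 0, …, v L` are the iterates, started at `w`, for the equation `V = w + h T(h, V)`; see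
`unrolledRhs` for the role of `ε`. -/
def IsUnrolling (T : ℝ → W → W) (ε : ℝ) (L : ℕ) (w : W) (v : ℕ → ℝ → W) : Prop :=
  ∀ᶠ h in 𝓝 (0 : ℝ), v 0 h = w ∧ ∀ l < L, v (l + 1) h =
    w + h • (T h (v l h) + ε • fderiv ℝ (T h) (v l h) (v (l + 1) h - v l h))

variable {T : ℝ → W → W} {ε : ℝ} {L : ℕ} {w : W} {v : ℕ → ℝ → W} {V : ℝ → W}

theorem IsUnrolling.tendsto (hv : IsUnrolling T ε L w v) (hT : ContDiff ℝ n (uncurry T))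
    (hn : n ≠ 0) {l : ℕ} (hl : l ≤ L) : Tendsto (v l) (𝓝 0) (𝓝 w) := by
  induction l with
  | zero => exact tendsto_const_nhds.congr' (hv.mono fun h hh => hh.1.symm)
  | succ l ih =>
    have hprev := ih (Nat.le_of_succ_le hl)
    have hderiv := isBigO_family_fderiv_apply hT hn hprev
    have hslope : (fun h => T h (v l h) + ε • fderiv ℝ (T h) (v l h) (w - v l h)) =O[𝓝 0]
        fun h : ℝ => h ^ 0 := by
      simp only [pow_zero]
      exact ((tendsto_family_apply hT.continuous hprev).isBigO_one ℝ).add (((hderiv _).trans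
        ((tendsto_const_nhds.sub hprev).isBigO_one ℝ)).const_smul_left ε)
    have hsub : (fun h => v (l + 1) h - w) =O[𝓝 0] fun h : ℝ => h ^ (0 + 1) := by
      refine (isBigO_of_eventually_eq_add_smul ?_ ((hderiv fun h => v (l + 1) h - w).const_smul_left
        ε)).trans (isBigO_smul_pow_succ hslope)
      filter_upwards [hv] with h hh
      rw [sub_eq_iff_eq_add'.2 (hh.2 l hl)]
      simp only [Pi.smul_apply, map_sub]
      module
    have hpow : Tendsto (fun h : ℝ => h ^ (0 + 1)) (𝓝 0) (𝓝 0) := by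
      simpa using (continuous_pow 1).tendsto (0 : ℝ)
    simpa only [sub_add_cancel, zero_add] using (hsub.trans_tendsto hpow).add_const w

theorem IsUnrolling.isBigO_sub_succ (hv : IsUnrolling T ε L w v) (hT : ContDiff ℝ n (uncurry T))
    (hn : n ≠ 0) (hV : IsBranch T w V) {l : ℕ} (hl : l < L) :
    (fun h => V h - v (l + 1) h) =O[𝓝 0] fun h =>
      h • (T h (V h) - T h (v l h) - ε • fderiv ℝ (T h) (v l h) (V h - v l h)) := by
  refine isBigO_of_eventually_eq_add_smul ?_ ((isBigO_family_fderiv_apply hT hn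
    (hv.tendsto hT hn hl.le) fun h => V h - v (l + 1) h).const_smul_left ε)
  filter_upwards [hv, hV.2] with h hh hVh
  calc V h - v (l + 1) h
    _ = (w + h • T h (V h)) -
        (w + h • (T h (v l h) + ε • fderiv ℝ (T h) (v l h) (v (l + 1) h - v l h))) := by
      rw [← hVh, ← hh.2 l hl]
    _ = _ := by
      simp only [Pi.smul_apply, map_sub]
      module

theorem IsUnrolling.isBigO_sub (hv : IsUnrolling T ε L w v) (hT : ContDiff ℝ n (uncurry T))
    (hn : n ≠ 0) (hV : IsBranch T w V) {r : ℕ}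
    (hlin : ∀ l < L, (fun h => T h (V h) - T h (v l h) -
      ε • fderiv ℝ (T h) (v l h) (V h - v l h)) =O[𝓝 0] fun h => ‖V h - v l h‖ ^ r)
    {l : ℕ} (hl : l ≤ L) :
    (fun h => V h - v l h) =O[𝓝 0] fun h : ℝ => h ^ ∑ k ∈ Finset.range (l + 1), r ^ k := by
  induction l with
  | zero =>
    refine ((hV.isBigO_sub hT.continuous).congr' (hv.mono fun h hh => ?_) .rfl).trans ?_
    · rw [hh.1]
    · simpa using isBigO_refl _ _
  | succ l ih =>
    have hpow := (ih (Nat.le_of_succ_le hl)).norm_left.pow r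
    simp only [← pow_mul'] at hpow
    rw [geom_sum_succ]
    exact (hv.isBigO_sub_succ hT hn hV hl).trans (isBigO_smul_pow_succ ((hlin l hl).trans hpow))

theorem isBranch_unrolledRhs_iff (hT : ContDiff ℝ n (uncurry T)) (hn : n ≠ 0) :
    IsBranch (fun h => unrolledRhs (T h) ε L) (fun _ => w) (fun h l => v l h) ↔
      IsUnrolling T ε L w v := by
  have hsystem : (∀ᶠ h in 𝓝 (0 : ℝ), (fun l : Fin (L + 1) => v l h) =
      (fun _ => w) + h • unrolledRhs (T h) ε L fun l => v l h) ↔ IsUnrolling T ε L w v := by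
    refine eventually_congr (.of_forall fun h => ?_)
    simp [funext_iff, Fin.forall_fin_succ, Fin.forall_iff, unrolledRhs]
  refine ⟨fun h => hsystem.1 h.2, fun h => ⟨tendsto_pi_nhds.2 fun l => ?_, hsystem.2 h⟩⟩
  exact h.tendsto hT hn (Nat.lt_succ_iff.1 l.2)

end Unrolling

section StageForms

variable {D s : ℕ}

/-- The weighted slope `∑ j, c j • g (V j)` from which stages and output of a Runge-Kutta scheme are
built. -/
def slopeSum {ι E F : Type*} [Fintype ι] [AddCommMonoid F] [Module ℝ F] (c : ι → ℝ) (g : E → F)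
    (V : ι → E) : F :=
  ∑ j, c j • g (V j)

theorem rkUpdate_eq_add_smul_slopeSum (b : Fin s → ℝ) (g : State D → State D) (h : ℝ) (x : State D)
    (v : Fin s → State D) : rkUpdate b g h x v = x + h • slopeSum b g v :=
  rfl

theorem contDiff_slopeSum {ι E F P : Type*} [Fintype ι] [NormedAddCommGroup E] [NormedSpace ℝ E]
    [NormedAddCommGroup F] [NormedSpace ℝ F] [NormedAddCommGroup P] [NormedSpace ℝ P]
    {n : WithTop ℕ∞} {G : P → E → F} (hG : ContDiff ℝ n (uncurry G)) (c : ι → ℝ) :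
    ContDiff ℝ n (uncurry fun t => slopeSum c (G t)) :=
  ContDiff.sum fun j _ => (hG.comp (contDiff_fst.prodMk
    ((contDiff_apply ℝ E j).comp contDiff_snd))).const_smul (c j)

theorem slopeSum_add_smul {ι E F : Type*} [Fintype ι] [AddCommMonoid F] [Module ℝ F] (c : ι → ℝ)
    (g k : E → F) (r : ℝ) (V : ι → E) :
    slopeSum c (fun x => g x + r • k x) V = slopeSum c g V + r • slopeSum c k V := by
  simp only [slopeSum, smul_add, Finset.sum_add_distrib, Finset.smul_sum, smul_comm r]

theorem slopeSum_const {ι E F : Type*} [Fintype ι] [AddCommMonoid F] [Module ℝ F] (c : ι → ℝ)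
    (g : E → F) (x : E) : slopeSum c g (fun _ => x) = (∑ j, c j) • g x :=
  Finset.sum_smul.symm

/-- A system of stage equations `V = init x + h rhs g V` in a space `W`, for a step of a scheme with
vector field `g` from `x`. The final update of the step uses the stages `last V` only, and `rhs` is
linear in `g`. -/
structure StageForm (D s : ℕ) (W : Type*) [NormedAddCommGroup W] [NormedSpace ℝ W] where
  init : State D →L[ℝ] W
  last : W →L[ℝ] (Fin s → State D)
  rhs : (State D → State D) → W → W
  last_init : ∀ x, last (init x) = fun _ => x
  contDiff_rhs : ∀ {G : ℝ → State D → State D}, ContDiff ℝ ∞ (uncurry G) →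
    ContDiff ℝ ∞ (uncurry fun h => rhs (G h))
  rhs_add_smul : ∀ {g k : State D → State D}, ContDiff ℝ ∞ g → ContDiff ℝ ∞ k → ∀ (c : ℝ) V,
    rhs (fun x => g x + c • k x) V = rhs g V + c • rhs k V

namespace StageForm

variable {W : Type*} [NormedAddCommGroup W] [NormedSpace ℝ W] (S : StageForm D s W)
  {b : Fin s → ℝ} {Φ : Scheme D} {G : ℝ → State D → State D} {x : State D} {z : ℝ → State D}

theorem contDiff_rhs_const {g : State D → State D} (hg : ContDiff ℝ ∞ g) :
    ContDiff ℝ ∞ (S.rhs g) :=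
  contDiff_family_apply (S.contDiff_rhs (G := fun _ => g) (hg.comp contDiff_snd)) 0

/-- The stage equations of all the iterates `0, …, L` of the iteration `unrolledRhs` for `S`. -/
noncomputable def unroll (ε : ℝ) (L : ℕ) : StageForm D s (Fin (L + 1) → W) where
  init := ContinuousLinearMap.pi fun _ => S.init
  last := S.last ∘L ContinuousLinearMap.proj (Fin.last L)
  rhs g := unrolledRhs (S.rhs g) ε L
  last_init := S.last_init
  contDiff_rhs hG := contDiff_unrolledRhs (S.contDiff_rhs hG) ε L
  rhs_add_smul {g k} hg hk c V := by
    rw [← unrolledRhs_add_smul ((S.contDiff_rhs_const hg).differentiable (by simp))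
      ((S.contDiff_rhs_const hk).differentiable (by simp)), funext (S.rhs_add_smul hg hk c)]

/-- `Φ` is the scheme with stage equations `S` and weights `b`. -/
def Presents (b : Fin s → ℝ) (Φ : Scheme D) : Prop :=
  ∀ ⦃G : ℝ → State D → State D⦄, ContDiff ℝ ∞ (uncurry G) → ∀ x z, Φ G x z ↔
    ∃ V, IsBranch (fun h => S.rhs (G h)) (S.init x) V ∧
      ∀ᶠ h in 𝓝 (0 : ℝ), z h = rkUpdate b (G h) h x (S.last (V h))

theorem presents_unroll_iff {ε : ℝ} {L : ℕ} : (S.unroll ε L).Presents b Φ ↔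
    ∀ ⦃G : ℝ → State D → State D⦄, ContDiff ℝ ∞ (uncurry G) → ∀ x z, Φ G x z ↔
      ∃ v, IsUnrolling (fun h => S.rhs (G h)) ε L (S.init x) v ∧
        ∀ᶠ h in 𝓝 (0 : ℝ), z h = rkUpdate b (G h) h x (S.last (v L h)) := by
  refine forall₂_congr fun G hG => forall₂_congr fun x z => iff_congr .rfl ?_
  have hiff (v : ℕ → ℝ → W) := isBranch_unrolledRhs_iff (ε := ε) (L := L) (w := S.init x) (v := v)
    (S.contDiff_rhs hG) (by simp)
  refine ⟨fun ⟨V, hV, hz⟩ => ?_, fun ⟨v, hv, hz⟩ => ⟨_, (hiff v).2 hv, hz⟩⟩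
  obtain ⟨v, rfl⟩ : ∃ v : ℕ → ℝ → W, (fun h (l : Fin (L + 1)) => v l h) = V :=
    ⟨fun l h => Function.extend Fin.val (V h) 0 l,
      funext fun h => funext fun l => Fin.val_injective.extend_apply (V h) 0 l⟩
  exact ⟨v, (hiff v).1 hV, hz⟩

/-- The stage equations of `S` with the result of the step, with weights `b`, as one more stage. -/
def outputRhs (b : Fin s → ℝ) (g : State D → State D) (p : W × State D) : W × State D :=
  (S.rhs g p.1, slopeSum b g (S.last p.1))

theorem contDiff_outputRhs (hG : ContDiff ℝ ∞ (uncurry G)) :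
    ContDiff ℝ ∞ (uncurry fun h => S.outputRhs b (G h)) :=
  ((S.contDiff_rhs hG).prodMk ((contDiff_slopeSum hG b).comp (contDiff_fst.prodMk
    (S.last.contDiff.comp contDiff_snd)))).comp
    (contDiff_fst.prodMk (contDiff_fst.comp contDiff_snd))

theorem outputRhs_add_smul {g k : State D → State D} (hg : ContDiff ℝ ∞ g) (hk : ContDiff ℝ ∞ k)
    (c : ℝ) (p : W × State D) : S.outputRhs b (fun x => g x + c • k x) p =
      S.outputRhs b g p + c • S.outputRhs b k p := by
  simp only [outputRhs, S.rhs_add_smul hg hk, slopeSum_add_smul, Prod.smul_mk, Prod.mk_add_mk]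

theorem Presents.iff_isBranch_outputRhs {S : StageForm D s W} (hΦ : S.Presents b Φ)
    (hG : ContDiff ℝ ∞ (uncurry G)) : Φ G x z ↔
      ∃ V : ℝ → W, IsBranch (fun h => S.outputRhs b (G h)) (S.init x, x) fun h => (V h, z h) := by
  rw [hΦ hG]
  have hsplit (V : ℝ → W) : (∀ᶠ h in 𝓝 (0 : ℝ), (V h, z h) =
      (S.init x, x) + h • S.outputRhs b (G h) (V h, z h)) ↔
      (∀ᶠ h in 𝓝 (0 : ℝ), V h = S.init x + h • S.rhs (G h) (V h)) ∧
        ∀ᶠ h in 𝓝 (0 : ℝ), z h = rkUpdate b (G h) h x (S.last (V h)) := by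
    simp only [← eventually_and, Prod.ext_iff]
    rfl
  refine exists_congr fun V => ⟨fun ⟨hV, hz⟩ => ⟨hV.1.prodMk_nhds ?_, (hsplit V).2 ⟨hV.2, hz⟩⟩,
    fun hP => ⟨⟨continuous_fst.continuousAt.tendsto.comp hP.1, ((hsplit V).1 hP.2).1⟩,
      ((hsplit V).1 hP.2).2⟩⟩
  have hslope := tendsto_family_apply (contDiff_slopeSum hG b).continuous
    ((S.last.continuous.tendsto _).comp hV.1)
  refine Tendsto.congr' (hz.mono fun h hh => hh.symm) ?_
  simpa [rkUpdate_eq_add_smul_slopeSum] using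
    (tendsto_const_nhds (x := x)).add ((tendsto_id (x := 𝓝 (0 : ℝ))).smul hslope)

end StageForm

/-- The properties of a one-step scheme that determine its inverse modified equation: for a smooth
`h`-dependent vector field, the scheme has a result, which expands in powers of `h` with smooth
coefficients, and adding `h ^ N • K` to the field adds `h ^ (N + 1) • β • K` to the result, to
leading order. -/
structure IsRegular (β : ℝ) (Φ : Scheme D) : Prop where
  exists_curve : ∀ {G}, ContDiff ℝ ∞ (uncurry G) → ∀ x, ∃ z, Φ G x z
  isBigO_sub : ∀ {G}, ContDiff ℝ ∞ (uncurry G) → ∀ {x z}, Φ G x z →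
    (fun h => z h - x) =O[𝓝 0] fun h : ℝ => h ^ 1
  exists_coeff : ∀ {G}, ContDiff ℝ ∞ (uncurry G) → ∀ n, ∃ c : ℕ → State D → State D,
    (∀ j, ContDiff ℝ ∞ (c j)) ∧ ∀ {x z}, Φ G x z → ExpandsTo z (fun j => c j x) n
  isBigO_perturb : ∀ {G}, ContDiff ℝ ∞ (uncurry G) → ∀ {K}, ContDiff ℝ ∞ K → ∀ {N x z z'},
    Φ G x z → Φ (fun h x => G h x + h ^ N • K x) x z' →
    (fun h => z' h - z h - h ^ (N + 1) • β • K x) =O[𝓝 0] fun h : ℝ => h ^ (N + 2)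

theorem StageForm.Presents.isRegular {W : Type*} [NormedAddCommGroup W] [NormedSpace ℝ W]
    [CompleteSpace W] {S : StageForm D s W} {b : Fin s → ℝ} {Φ : Scheme D}
    (hΦ : S.Presents b Φ) : IsRegular (∑ i, b i) Φ where
  exists_curve hG x :=
    have ⟨P, hP⟩ := exists_isBranch (S.contDiff_outputRhs (b := b) hG) (by simp) (S.init x, x)
    ⟨fun h => (P h).2, (hΦ.iff_isBranch_outputRhs hG).2 ⟨fun h => (P h).1, hP⟩⟩
  isBigO_sub hG x z hz :=
    have ⟨_, hV⟩ := (hΦ.iff_isBranch_outputRhs hG).1 hz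
    isBigO_snd_prod.trans (hV.isBigO_sub (S.contDiff_outputRhs hG).continuous)
  exists_coeff {G} hG n := by
    have hT := S.contDiff_outputRhs (b := b) hG
    have hpicard : ContDiff ℝ ∞ (uncurry fun h x =>
        (picardIterate (fun h => S.outputRhs b (G h)) n h (S.init x, x)).2) :=
      contDiff_snd.comp ((contDiff_picardIterate hT n).comp
        (contDiff_fst.prodMk ((S.init.contDiff.prodMk contDiff_id).comp contDiff_snd)))
    obtain ⟨c, hc, hpicard_c⟩ := exists_contDiff_coeff hpicard
    refine ⟨c, hc, fun {x z} hz => ?_⟩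
    obtain ⟨V, hV⟩ := (hΦ.iff_isBranch_outputRhs hG).1 hz
    refine ((isBigO_snd_prod.trans (hV.isBigO_sub_picardIterate hT (by simp) n)).add
      (hpicard_c x (n + 1))).congr_left fun h => ?_
    exact sub_add_sub_cancel _ _ _
  isBigO_perturb {G} hG {K} hK {N x z z'} hz hz' := by
    obtain ⟨V, hV⟩ := (hΦ.iff_isBranch_outputRhs hG).1 hz
    obtain ⟨V', hV'⟩ := (hΦ.iff_isBranch_outputRhs (contDiff_family_add_pow_smul hG hK N)).1 hz'
    simp only [funext (S.outputRhs_add_smul (contDiff_family_apply hG _) hK _)] at hV'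
    have hK' : ContDiff ℝ ∞ (S.outputRhs b K) :=
      contDiff_family_apply (S.contDiff_outputRhs (G := fun _ => K) (hK.comp contDiff_snd)) 0
    have := hV.isBigO_sub_sub_of_perturb (S.contDiff_outputRhs hG) hK' (by simp) hV'
    simpa only [StageForm.outputRhs, S.last_init, slopeSum_const, Prod.snd_sub, Prod.smul_snd] using
      isBigO_snd_prod.trans this

end StageForms

section Schemes

variable {D s : ℕ}

/-- The schemes `Φ` and `Ψ` agree up to `O(h ^ p)` on smooth `h`-dependent vector fields. -/
def AgreeToOrder (p : ℕ) (Φ Ψ : Scheme D) : Prop :=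
  ∀ ⦃G⦄, ContDiff ℝ ∞ (uncurry G) → ∀ ⦃x z z'⦄, Φ G x z → Ψ G x z' →
    (fun h => z h - z' h) =O[𝓝 0] fun h : ℝ => h ^ p

theorem IsRegular.agreeToOrder_self {β : ℝ} {Φ : Scheme D} (hΦ : IsRegular β Φ) (n : ℕ) :
    AgreeToOrder (n + 1) Φ Φ := by
  intro G hG x z z' hz hz'
  obtain ⟨c, -, hc⟩ := hΦ.exists_coeff hG n
  exact ((hc hz).sub (hc hz')).congr_left fun h => sub_sub_sub_cancel_right _ _ _

theorem StageForm.Presents.agreeToOrder_unroll {W : Type*} [NormedAddCommGroup W] [NormedSpace ℝ W]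
    {S : StageForm D s W} {b : Fin s → ℝ} {Φ Ψ : Scheme D} {ε : ℝ} {L r : ℕ}
    (hΦ : S.Presents b Φ) (hΨ : (S.unroll ε L).Presents b Ψ)
    (hlin : ∀ {T : ℝ → W → W}, ContDiff ℝ ∞ (uncurry T) → ∀ {w : W} {u v : ℝ → W},
      Tendsto u (𝓝 0) (𝓝 w) → Tendsto v (𝓝 0) (𝓝 w) →
      (fun h => T h (u h) - T h (v h) - ε • fderiv ℝ (T h) (v h) (u h - v h)) =O[𝓝 0]
        fun h => ‖u h - v h‖ ^ r) :
    AgreeToOrder (∑ k ∈ Finset.range (L + 1), r ^ k + 1) Φ Ψ := by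
  intro G hG x z z' hz hz'
  have hT := S.contDiff_rhs hG
  obtain ⟨V, hV, hzV⟩ := (hΦ hG x z).1 hz
  obtain ⟨v, hv, hzv⟩ := (S.presents_unroll_iff.1 hΨ hG x z').1 hz'
  have hvL := hv.tendsto hT (by simp) le_rfl
  have hstages := hv.isBigO_sub hT (by simp) hV
    (fun l hl => hlin hT hV.1 (hv.tendsto hT (by simp) hl.le)) le_rfl
  have hslope : ContDiff ℝ ∞ (uncurry fun h V => slopeSum b (G h) (S.last V)) :=
    (contDiff_slopeSum hG b).comp (contDiff_fst.prodMk (S.last.contDiff.comp contDiff_snd))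
  refine (isBigO_smul_pow_succ ((isBigO_family_sub hslope (by simp) hV.1 hvL).trans
    hstages)).congr' ?_ .rfl
  filter_upwards [hzV, hzv] with h hzVh hzvh
  rw [hzVh, hzvh, rkUpdate_eq_add_smul_slopeSum, rkUpdate_eq_add_smul_slopeSum,
    add_sub_add_left_eq_sub, smul_sub]

/-- The stage equations `v i = x + h ∑ j, a i j • g (v j)` of the Runge-Kutta scheme with
coefficients `a`. -/
noncomputable def rkForm (a : Matrix (Fin s) (Fin s) ℝ) : StageForm D s (Fin s → State D) where
  init := ContinuousLinearMap.pi fun _ => .id ℝ _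
  last := .id ℝ _
  rhs g V i := slopeSum (a i) g V
  last_init _ := rfl
  contDiff_rhs hG := contDiff_pi.2 fun i => contDiff_slopeSum hG (a i)
  rhs_add_smul _ _ c V := funext fun i => slopeSum_add_smul (a i) _ _ c V

theorem fderiv_rkForm_rhs_apply (a : Matrix (Fin s) (Fin s) ℝ) {g : State D → State D}
    (hg : Differentiable ℝ g) (V U : Fin s → State D) (i : Fin s) :
    fderiv ℝ ((rkForm a).rhs g) V U i = ∑ j, a i j • fderiv ℝ g (V j) (U j) := by
  have hrhs : HasFDerivAt (fun V i => ∑ j, a i j • g (V j)) (ContinuousLinearMap.pi fun i =>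
      ∑ j, a i j • (fderiv ℝ g (V j)).comp (ContinuousLinearMap.proj j)) V :=
    hasFDerivAt_pi.2 fun i => HasFDerivAt.fun_sum fun j _ =>
      ((hg (V j)).hasFDerivAt.comp V (hasFDerivAt_apply j V)).const_smul (a i j)
  have hfderiv : fderiv ℝ ((rkForm a).rhs g) V = _ := hrhs.fderiv
  simp [hfderiv]

variable (a : Matrix (Fin s) (Fin s) ℝ) (b : Fin s → ℝ) (L : ℕ)

theorem presents_exactRK : (rkForm a).Presents b (exactRK (D := D) a b) := by
  intro G _ x z
  refine exists_congr fun V => ?_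
  rw [IsBranch, and_assoc, ← eventually_and]
  simp only [funext_iff]
  rfl

theorem presents_fixedPointRK :
    ((rkForm a).unroll 0 L).Presents b (fixedPointRK (D := D) a b L) := by
  refine (rkForm a).presents_unroll_iff.2 fun G _ x z => exists_congr fun v => ?_
  rw [IsUnrolling, ← eventually_and]
  simp only [funext_iff, and_assoc, zero_smul, add_zero]
  rfl

theorem presents_newtonRK :
    ((rkForm a).unroll 1 L).Presents b (newtonRK (D := D) a b L) := by
  refine (rkForm a).presents_unroll_iff.2 fun G hG x z => exists_congr fun v => ?_
  have hfderiv (h : ℝ) := fderiv_rkForm_rhs_apply a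
    ((contDiff_family_apply hG h).differentiable (by simp))
  rw [IsUnrolling, ← eventually_and]
  simp only [funext_iff, and_assoc, one_smul, Pi.add_apply, Pi.smul_apply, hfderiv, smul_add,
    Finset.sum_add_distrib]
  rfl

theorem agreeToOrder_exactRK_fixedPointRK :
    AgreeToOrder (L + 2) (exactRK (D := D) a b) (fixedPointRK a b L) := by
  have := (presents_exactRK a b).agreeToOrder_unroll (D := D) (r := 1)
    (presents_fixedPointRK a b L) fun hT _ _ _ hu hv => by
      simpa using (isBigO_family_sub hT (by simp) hu hv).norm_right
  simpa using this

theorem agreeToOrder_exactRK_newtonRK :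
    AgreeToOrder (2 ^ (L + 1) - 2 + 2) (exactRK (D := D) a b) (newtonRK a b L) := by
  have := (presents_exactRK a b).agreeToOrder_unroll (D := D) (r := 2)
    (presents_newtonRK a b L) fun hT _ _ _ hu hv => by
      simpa using isBigO_family_sub_sub_fderiv hT ENat.LEInfty.out hu hv
  have hpow : 2 ^ 1 ≤ 2 ^ (L + 1) := Nat.pow_le_pow_right two_pos (Nat.le_add_left 1 L)
  convert this using 1
  rw [Nat.geomSum_eq le_rfl]
  lia

end Schemes

section InverseModifiedEquation

variable {D : ℕ} {Φ Ψ : Scheme D} {β : ℝ} {d : ℕ → State D → State D}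

theorem truncation_succ (F : ℕ → State D → State D) (N : ℕ) :
    truncation F (N + 1) = fun h x => truncation F N h x + h ^ (N + 1) • F (N + 1) x :=
  funext₂ fun _ _ => Finset.sum_range_succ _ _

theorem contDiff_truncation {F : ℕ → State D → State D} (hF : ∀ k, ContDiff ℝ ∞ (F k)) (N : ℕ) :
    ContDiff ℝ ∞ (uncurry (truncation F N)) := by
  induction N with
  | zero =>
    have hzero : uncurry (truncation F 0) = F 0 ∘ Prod.snd :=
      funext fun p => by simp [uncurry, truncation]
    exact hzero ▸ (hF 0).comp contDiff_snd
  | succ N ih =>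
    rw [truncation_succ]
    exact contDiff_family_add_pow_smul ih (hF (N + 1)) (N + 1)

theorem IsRegular.exists_correction (hΦ : IsRegular β Φ) (hβ : β ≠ 0)
    (hd : ∀ j, ContDiff ℝ ∞ (d j)) {G : ℝ → State D → State D} (hG : ContDiff ℝ ∞ (uncurry G))
    {N : ℕ} (hGd : ∀ x z, Φ G x z → ExpandsTo z (fun j => d j x) N) :
    ∃ K : State D → State D, ContDiff ℝ ∞ K ∧
      ∀ x z, Φ (fun h x => G h x + h ^ N • K x) x z → ExpandsTo z (fun j => d j x) (N + 1) := by
  obtain ⟨c, hc, hGc⟩ := hΦ.exists_coeff hG (N + 1)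
  have hK : ContDiff ℝ ∞ fun x => β⁻¹ • (d (N + 1) x - c (N + 1) x) :=
    ((hd (N + 1)).sub (hc (N + 1))).const_smul β⁻¹
  refine ⟨_, hK, fun x z hz => ?_⟩
  obtain ⟨z₀, hz₀⟩ := hΦ.exists_curve hG x
  have hcd : ∀ j ∈ Finset.range (N + 1), c j x = d j x := fun j hj =>
    (hGc hz₀).of_succ.coeff_eq (hGd x z₀ hz₀) (Finset.mem_range_succ_iff.1 hj)
  refine ((hΦ.isBigO_perturb hG hK hz₀ hz).add (hGc hz₀)).congr_left fun t => ?_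
  simp only [Finset.sum_range_succ _ (N + 1), smul_inv_smul₀ hβ]
  rw [Finset.sum_congr rfl fun j hj => by rw [hcd j hj]]
  module

theorem IsRegular.exists_isSchemeSeries (hΦ : IsRegular β Φ) (hβ : β ≠ 0)
    (hd : ∀ j, ContDiff ℝ ∞ (d j)) (hd0 : ∀ x, d 0 x = x) :
    ∃ F : ℕ → State D → State D, (∀ k, ContDiff ℝ ∞ (F k)) ∧
      ∀ x, IsSchemeSeries Φ F x fun j => d j x := by
  let Matches (N : ℕ) (G : ℝ → State D → State D) : Prop :=
    ContDiff ℝ ∞ (uncurry G) ∧ ∀ x z, Φ G x z → ExpandsTo z (fun j => d j x) N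
  have hstep (N : ℕ) (G : ℝ → State D → State D) (hG : Matches N G) :
      ∃ K : State D → State D, ContDiff ℝ ∞ K ∧ Matches (N + 1) fun h x => G h x + h ^ N • K x :=
    have ⟨K, hK, hGK⟩ := hΦ.exists_correction hβ hd hG.1 hG.2
    ⟨K, hK, contDiff_family_add_pow_smul hG.1 hK N, hGK⟩
  choose! K hK hmatch using hstep
  let G : ℕ → ℝ → State D → State D :=
    Nat.rec (fun _ _ => 0) fun N g h x => g h x + h ^ N • K N g x
  have hG : ∀ N, Matches N (G N) := fun N => by
    induction N with
    | zero => exact ⟨contDiff_const, fun x z hz => by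
        simpa [ExpandsTo, hd0] using hΦ.isBigO_sub contDiff_const hz⟩
    | succ N ih => exact hmatch N (G N) ih
  have htruncation (N : ℕ) : truncation (fun k => K k (G k)) N = G (N + 1) := by
    induction N with
    | zero => exact funext₂ fun h x => Finset.sum_range_succ _ 0
    | succ N ih => rw [truncation_succ, ih]
  refine ⟨fun k => K k (G k), fun k => hK k (G k) (hG k), fun x N => ?_⟩
  obtain ⟨z, hz⟩ := hΦ.exists_curve (hG (N + 1)).1 x
  exact ⟨z, (htruncation N).symm ▸ hz, (hG (N + 1)).2 x z hz⟩

theorem IsRegular.coeff_eq_of_agreeToOrder (hΦ : IsRegular β Φ) (hβ : β ≠ 0) {M : ℕ}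
    (hΦΨ : AgreeToOrder (M + 2) Φ Ψ) {F F' : ℕ → State D → State D}
    (hF : ∀ k, ContDiff ℝ ∞ (F k)) (hF' : ∀ k, ContDiff ℝ ∞ (F' k))
    (hFd : ∀ x, IsSchemeSeries Φ F x fun j => d j x)
    (hFd' : ∀ x, IsSchemeSeries Ψ F' x fun j => d j x) : ∀ k ≤ M, F k = F' k := by
  intro k
  induction k using Nat.strong_induction_on with
  | _ k ih =>
    intro hk
    funext x
    have htruncation : truncation F k =
        fun h x => truncation F' k h x + h ^ k • (F k x - F' k x) := by
      funext h y
      simp only [truncation, Finset.sum_range_succ]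
      rw [Finset.sum_congr rfl fun j hj => by
        rw [ih j (Finset.mem_range.1 hj) ((Finset.mem_range.1 hj).le.trans hk)]]
      module
    obtain ⟨z, hz, hzd⟩ := hFd x k
    obtain ⟨z', hz', hzd'⟩ := hFd' x k
    have hG := contDiff_truncation hF' k
    obtain ⟨w, hw⟩ := hΦ.exists_curve hG x
    rw [htruncation] at hz
    have hzw := hΦ.isBigO_perturb hG ((hF k).sub (hF' k)) hw hz
    have hwz' := (hΦΨ hG hw hz').trans (isBigO_pow_pow_of_le (Nat.add_le_add_right hk 2))
    have hzero : β • (F k x - F' k x) = 0 := by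
      refine eq_zero_of_pow_smul_isBigO (k := k + 1) ?_
      refine (((hzd.sub hzd').sub hzw).sub hwz').congr_left fun t => ?_
      abel
    exact sub_eq_zero.1 ((smul_eq_zero_iff_right hβ).1 hzero)

variable {f : State D → State D}

theorem IsIMDE.eq_of_agreeToOrder (hf : ContDiff ℝ ∞ f) (hΦ : IsRegular β Φ) (hβ : β ≠ 0) {M : ℕ}
    (hΦΨ : AgreeToOrder (M + 2) Φ Ψ) {F F' : ℕ → State D → State D} (hF : IsIMDE Φ f F)
    (hF' : IsIMDE Ψ f F') : ∀ k ≤ M, F k = F' k :=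
  have ⟨hF, hFd⟩ := (isIMDE_iff hf).1 hF
  have ⟨hF', hFd'⟩ := (isIMDE_iff hf).1 hF'
  hΦ.coeff_eq_of_agreeToOrder hβ hΦΨ hF hF' hFd hFd'

theorem IsRegular.existsUnique_isIMDE (hΦ : IsRegular β Φ) (hβ : β ≠ 0) (hf : ContDiff ℝ ∞ f) :
    ∃! F, IsIMDE Φ f F := by
  obtain ⟨F, hF⟩ := hΦ.exists_isSchemeSeries hβ (contDiff_flowCoeff hf) fun _ => flowCoeff_zero _
  have hFf := (isIMDE_iff hf).2 hF
  exact ⟨F, hFf, fun F' hF' => funext fun k =>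
    hF'.eq_of_agreeToOrder hf hΦ hβ (hΦ.agreeToOrder_self (k + 1)) hFf k le_rfl⟩

end InverseModifiedEquation

end UnrolledRK

theorem mainTheorem2_general {D s : ℕ} (a : Matrix (Fin s) (Fin s) ℝ) (b : Fin s → ℝ)
    (hb : ∑ i, b i ≠ 0) (L : ℕ)
    (f : UnrolledRK.State D → UnrolledRK.State D) (hf : ContDiff ℝ ∞ f) :
    (∃! fHat, UnrolledRK.IsIMDE (UnrolledRK.exactRK a b) f fHat) ∧
    (∃! F, UnrolledRK.IsIMDE (UnrolledRK.fixedPointRK a b L) f F) ∧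
    (∃! F, UnrolledRK.IsIMDE (UnrolledRK.newtonRK a b L) f F) ∧
    (∀ fHat F, UnrolledRK.IsIMDE (UnrolledRK.exactRK a b) f fHat →
      UnrolledRK.IsIMDE (UnrolledRK.fixedPointRK a b L) f F →
      ∀ k ≤ L, fHat k = F k) ∧
    (∀ fHat F, UnrolledRK.IsIMDE (UnrolledRK.exactRK a b) f fHat →
      UnrolledRK.IsIMDE (UnrolledRK.newtonRK a b L) f F →
      ∀ k ≤ 2 ^ (L + 1) - 2, fHat k = F k) := by
  have hexact := (UnrolledRK.presents_exactRK (D := D) a b).isRegular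
  have hfixed := (UnrolledRK.presents_fixedPointRK (D := D) a b L).isRegular
  have hnewton := (UnrolledRK.presents_newtonRK (D := D) a b L).isRegular
  refine ⟨hexact.existsUnique_isIMDE hb hf, hfixed.existsUnique_isIMDE hb hf,
    hnewton.existsUnique_isIMDE hb hf, fun fHat F hfHat hF => ?_, fun fHat F hfHat hF => ?_⟩
  · exact hfHat.eq_of_agreeToOrder hf hexact hb
      (UnrolledRK.agreeToOrder_exactRK_fixedPointRK a b L) hF
  · exact hfHat.eq_of_agreeToOrder hf hexact hb
      (UnrolledRK.agreeToOrder_exactRK_newtonRK a b L) hF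

theorem mainTheorem2 {D s : ℕ} (a : Matrix (Fin s) (Fin s) ℝ) (b : Fin s → ℝ)
    (hb : ∑ i, b i = 1) (L : ℕ)
    (f : UnrolledRK.State D → UnrolledRK.State D) (hf : ContDiff ℝ ∞ f) :
    (∃! fHat, UnrolledRK.IsIMDE (UnrolledRK.exactRK a b) f fHat) ∧
    (∃! F, UnrolledRK.IsIMDE (UnrolledRK.fixedPointRK a b L) f F) ∧
    (∃! F, UnrolledRK.IsIMDE (UnrolledRK.newtonRK a b L) f F) ∧
    (∀ fHat F, UnrolledRK.IsIMDE (UnrolledRK.exactRK a b) f fHat →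
      UnrolledRK.IsIMDE (UnrolledRK.fixedPointRK a b L) f F →
      ∀ k ≤ L, fHat k = F k) ∧
    (∀ fHat F, UnrolledRK.IsIMDE (UnrolledRK.exactRK a b) f fHat →
      UnrolledRK.IsIMDE (UnrolledRK.newtonRK a b L) f F →
      ∀ k ≤ 2 ^ (L + 1) - 2, fHat k = F k) :=
  mainTheorem2_general a b (by simp [hb]) L f hf
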